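/- For a group $G$ put $[x,y]=x^{-1}y^{-1}xy$, $G_1=G$ and $G_{k+1}=[G_k,G]$ for $k\ge 1$. For $c\ge 1$ let $\mathcal N_c$ denote the class of all nilpotent groups of class at most $c$, i.e. of all groups $K$ with $K_{c+1}=\{e\}$. For $G\in\mathcal N_c$ and a subgroup $H$ of $G$, the dominion of $H$ in $G$ in the category $\mathcal N_c$ is $$\mathrm{dom}_G^{\mathcal N_c}(H)=\bigl\{g\in G \;\big|\; \text{for all } K\in\mathcal N_c \text{ and all homomorphisms } f,f'\colon G\to K,\ \text{if } f|_H=f'|_H \text{ then } f(g)=f'(g)\bigr\}.$$ Let $c>1$ be an integer and $p$ a prime, and write $\mathrm{ord}_p(c!)$ for the exponent of the highest power of $p$ dividing $c!$. Let $G\in\mathcal N_2$, let $H$ be a subgroup of $G$, and let $a\ge 0$ and $N$ be integers with $N\ge (c-2)\,\mathrm{ord}_p(c!)+a$. If $x,y\in G$ are such that $x^{p^N}\in H$ and $y^{p^N}\in H$, then $$[x,y]^{p^{2N-a}}\in \mathrm{dom}_G^{\mathcal N_c}(H).$$ -/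

import Mathlib

universe u v

/-- The class `𝒩_c` of all nilpotent groups of class at most `c`. Mathlib's lower central series
starts at index `0` with the whole group, so its term of index `c` is the `(c+1)`-st term of the
lower central series `G₁ = G`, `G_{k+1} = [G_k, G]`. -/
def NilpotentClassLE (c : ℕ) (G : Type u) [Group G] : Prop :=
  (⊤ : Subgroup G).lowerCentralSeries c = ⊥

/-- The dominion of a subgroup `H` of `G` in the category `𝒞` (a full subcategory of the category
of groups, given as a class of groups): the subgroup of all `a : G` such that any two morphisms
from `G` to a member of `𝒞` that agree on `H` also agree at `a`. -/
def dominion {G : Type u} [Group G] (𝒞 : (K : Type v) → [Group K] → Prop) (H : Subgroup G) :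
    Subgroup G where
  carrier := {a | ∀ (K : Type v) [Group K], 𝒞 K → ∀ f g : G →* K,
    (∀ h ∈ H, f h = g h) → f a = g a}
  mul_mem' := by
    intro a b ha hb K _ hK f g hfg
    rw [map_mul, map_mul, ha K hK f g hfg, hb K hK f g hfg]
  one_mem' := by
    intro K _ _ f g _
    rw [map_one, map_one]
  inv_mem' := by
    intro a ha K _ hK f g hfg
    rw [map_inv, map_inv, ha K hK f g hfg]

/-- The commutator with the convention `x * y = y * x * [x, y]`. -/
def rightCommutator {G : Type u} [Group G] (x y : G) : G :=
  x⁻¹ * y⁻¹ * x * y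

/-! Let q = p^N, K_i = `lcsTerm K i`, W_j = `lcsPowers K p N j`. If f, g agree on H, put X = g x and
Y = f y. As G has class 2, [X^q, Y] = f [x^q, y] commutes with Y, and [Y^q, X] = g [y^q, x] with X.
It remains to show that [X^q, Y] and [X, Y^q] have equal p^n-th powers for n ≥ (c - 2) ord_p(c!)
(`commutator_pow_pow_eq`).

Both agree with [X, Y]^q modulo W_3: the defect is a polynomial sequence in the exponent, so a
product of binomial powers (`mem_of_choose`), and binomials of p-powers are highly divisible by p.
Each W_j is central modulo W_{j+1}. The commutation relations make q-th powers of K_2 central modulo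
W_4, which forces q-th powers of K_i into W_{i+1} for i ≥ 3. So each power of exponent p^ord_p(c!)
pushes W_j into W_{j+1}, and c - 2 of them kill the defect (`mul_pow_eq`). -/

open scoped commutatorElement

/-- The lower central series of `K`, indexed so that the terms of index `0` and `1` are `K`. -/
def lcsTerm (K : Type v) [Group K] (i : ℕ) : Subgroup K :=
  (⊤ : Subgroup K).lowerCentralSeries (i - 1)

/-! ### Lower central series -/

section LowerCentralSeries

variable {K : Type v} [Group K]

instance lcsTerm_normal (i : ℕ) : (lcsTerm K i).Normal :=
  Subgroup.lowerCentralSeries_normal _ _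

lemma lcsTerm_antitone : Antitone (lcsTerm K) := fun _ _ h =>
  Subgroup.lowerCentralSeries_antitone _ (Nat.sub_le_sub_right h 1)

lemma lcsTerm_succ {i : ℕ} (hi : 1 ≤ i) : lcsTerm K (i + 1) = ⁅lcsTerm K i, ⊤⁆ := by
  obtain ⟨j, rfl⟩ := Nat.exists_eq_add_of_le' hi
  rfl

lemma commutator_commutator_le_of_rotate {A B C N : Subgroup K} [N.Normal]
    (h1 : ⁅⁅B, C⁆, A⁆ ≤ N) (h2 : ⁅⁅C, A⁆, B⁆ ≤ N) : ⁅⁅A, B⁆, C⁆ ≤ N := by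
  have key : ∀ X : Subgroup K, X ≤ N ↔ X.map (QuotientGroup.mk' N) = ⊥ := fun X => by
    rw [Subgroup.map_eq_bot_iff, QuotientGroup.ker_mk']
  rw [key, Subgroup.map_commutator, Subgroup.map_commutator] at *
  exact Subgroup.commutator_commutator_eq_bot_of_rotate h1 h2

lemma commutator_lowerCentralSeries_le (i j : ℕ) :
    ⁅(⊤ : Subgroup K).lowerCentralSeries i, (⊤ : Subgroup K).lowerCentralSeries j⁆ ≤
      (⊤ : Subgroup K).lowerCentralSeries (i + j + 1) := by
  induction j generalizing i with
  | zero => exact le_rfl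
  | succ j ih =>
    rw [Subgroup.commutator_comm, Subgroup.lowerCentralSeries_succ _ j]
    refine commutator_commutator_le_of_rotate ?_ ?_
    · rw [Subgroup.commutator_comm ⊤]
      refine (ih (i + 1)).trans (Subgroup.lowerCentralSeries_antitone _ (by omega))
    · exact Subgroup.commutator_mono (ih i) le_rfl

lemma commutator_lcsTerm_le (i j : ℕ) : ⁅lcsTerm K i, lcsTerm K j⁆ ≤ lcsTerm K (i + j) := by
  rcases Nat.eq_zero_or_pos i with rfl | hi
  · rw [zero_add]; exact Subgroup.commutator_le_right _ _
  rcases Nat.eq_zero_or_pos j with rfl | hj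
  · exact Subgroup.commutator_le_left _ _
  refine (commutator_lowerCentralSeries_le (i - 1) (j - 1)).trans
    (Subgroup.lowerCentralSeries_antitone _ (by omega))

lemma commutator_mem_lcsTerm {i j : ℕ} {g h : K} (hg : g ∈ lcsTerm K i) (hh : h ∈ lcsTerm K j) :
    ⁅g, h⁆ ∈ lcsTerm K (i + j) :=
  commutator_lcsTerm_le i j (Subgroup.commutator_mem_commutator hg hh)

end LowerCentralSeries

/-! ### Polynomial sequences and Taylor expansion -/

/-- Polynomial sequences of degree filtration `d` with respect to the lower central series: the
smallest filtration of sequences that contains `n ↦ g ^ (n choose i)` in degree `d` whenever `g`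
lies in the term of index `i + d`. -/
inductive PolySeq {K : Type v} [Group K] : ℕ → (ℕ → K) → Prop
  | binom {d i : ℕ} {g : K} (hg : g ∈ lcsTerm K (i + d)) : PolySeq d (fun n => g ^ n.choose i)
  | mul {d : ℕ} {f g : ℕ → K} (hf : PolySeq d f) (hg : PolySeq d g) : PolySeq d (f * g)
  | inv {d : ℕ} {f : ℕ → K} (hf : PolySeq d f) : PolySeq d f⁻¹
  | comm {d e : ℕ} {f g : ℕ → K} (hf : PolySeq d f) (hg : PolySeq e g) : PolySeq (d + e) ⁅f, g⁆
  | pred {d : ℕ} {f : ℕ → K} (hf : PolySeq (d + 1) f) : PolySeq d f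

namespace PolySeq

variable {K : Type v} [Group K] {d e : ℕ} {f g : ℕ → K}

lemma mono (hde : e ≤ d) (hf : PolySeq d f) : PolySeq e f := by
  induction hde with
  | refl => exact hf
  | step _ ih => exact ih hf.pred

lemma conj (hf : PolySeq e f) (hg : PolySeq d g) : PolySeq d (f * g * f⁻¹) := by
  have h := ((hf.comm hg).mono (Nat.le_add_left d e)).mul hg
  rwa [commutatorElement_def, inv_mul_cancel_right] at h

lemma conj' (hf : PolySeq e f) (hg : PolySeq d g) : PolySeq d (f⁻¹ * g * f) := by
  simpa using hf.inv.conj hg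

lemma pow {x : K} {d : ℕ} (hx : x ∈ lcsTerm K (1 + d)) : PolySeq d (fun n => x ^ n) := by
  simpa using binom hx

lemma const {x : K} {d : ℕ} (hx : x ∈ lcsTerm K d) : PolySeq d (fun _ => x) := by
  simpa using binom (i := 0) (d := d) (by simpa using hx)

lemma mem_lcsTerm (hf : PolySeq d f) (n : ℕ) : f n ∈ lcsTerm K d := by
  induction hf with
  | binom hg => exact pow_mem (lcsTerm_antitone (Nat.le_add_left _ _) hg) _
  | mul _ _ h1 h2 => exact mul_mem h1 h2
  | inv _ h => exact inv_mem h
  | comm _ _ h1 h2 => exact commutator_mem_lcsTerm h1 h2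
  | pred _ h => exact lcsTerm_antitone (Nat.le_succ _) h

/-- Leibniz rules for products, inverses and commutators reduce this to Pascal's rule. -/
lemma diff (hf : PolySeq d f) : PolySeq (d + 1) (f⁻¹ * fun n => f (n + 1)) := by
  induction hf with
  | @binom d i g hg =>
    rcases i with _ | i
    · convert const (one_mem (lcsTerm K (d + 1))) using 1
      ext n
      simp
    · convert binom (d := d + 1) (i := i) (g := g)
        (by rwa [show i + (d + 1) = i + 1 + d by omega]) using 1
      ext n
      simp only [Pi.mul_apply, Pi.inv_apply, Nat.choose_succ_succ']
      rw [add_comm (n.choose i), pow_add, inv_mul_cancel_left]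
  | @mul d f g _ hg h1 h2 =>
    convert (hg.conj' h1).mul h2 using 1
    ext n
    simp only [Pi.mul_apply, Pi.inv_apply]
    group
  | @inv d f hf h =>
    convert hf.conj h.inv using 1
    ext n
    simp only [Pi.mul_apply, Pi.inv_apply]
    group
  | @comm d e f g hf hg h1 h2 =>
    -- With f', g' the shifts, [f', g'] = f[f⁻¹f', g']f⁻¹ · [f, g] · g[f, g⁻¹g']g⁻¹.
    have hX := hf.conj (h1.comm (hg.mul (h2.mono (Nat.le_succ e))))
    have hY := hg.conj (hf.comm h2)
    rw [show d + 1 + e = d + e + 1 by omega] at hX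
    convert ((hf.comm hg).conj' hX).mul hY using 1
    ext n
    simp only [Pi.mul_apply, Pi.inv_apply, commutatorElement_def]
    group
  | pred _ h => exact h.pred

lemma mem_lcsTerm_of_eq_one (k : ℕ) (hf : PolySeq d f) (h : ∀ i < k, f i = 1) :
    f k ∈ lcsTerm K (d + k) := by
  induction k generalizing d f with
  | zero => exact hf.mem_lcsTerm 0
  | succ k ih =>
    have h' := ih hf.diff fun i hi => by simp [h i (by omega), h (i + 1) (by omega)]
    rw [show d + 1 + k = d + (k + 1) by omega] at h'
    simpa [h k (by omega)] using h'

/-- Taylor expansion: a sequence trivial below k has f k in the term of index d + k, so dividing by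
f k ^ (n choose k) makes it trivial up to k. Repeat until k > n. -/
lemma mem_of_choose (hf : PolySeq d f) (h0 : f 0 = 1) (h1 : f 1 = 1) (n : ℕ) (V : Subgroup K)
    (hV : ∀ i, 2 ≤ i → ∀ g ∈ lcsTerm K (d + i), g ^ n.choose i ∈ V) : f n ∈ V := by
  have key : ∀ m k, 2 ≤ k → n + 1 ≤ k + m → ∀ f : ℕ → K, PolySeq d f → (∀ i < k, f i = 1) →
      f n ∈ V := by
    intro m
    induction m with
    | zero =>
      intro k _ hk f _ hfk
      rw [hfk n (by omega)]
      exact one_mem V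
    | succ m ih =>
      intro k hk hkm f hf hfk
      have hmem := hf.mem_lcsTerm_of_eq_one k hfk
      have hE : PolySeq d (fun n => f k ^ n.choose k) := binom (by rwa [add_comm])
      have := ih (k + 1) (by omega) (by omega) _ (hf.mul hE.inv) fun i hi => by
        rcases Nat.lt_succ_iff_lt_or_eq.mp hi with hi | rfl
        · simp [hfk i hi, Nat.choose_eq_zero_of_lt hi]
        · simp
      simpa using mul_mem this (hV k hk _ hmem)
  refine key n 2 le_rfl (by omega) f hf fun i hi => ?_
  interval_cases i <;> assumption

end PolySeq

/-! ### Valuations of binomials and factorials -/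

section Valuation

variable {p : ℕ}

lemma pow_sub_padicValNat_dvd_choose (hp : p.Prime) (m : ℕ) {l : ℕ} (hl : 1 ≤ l) :
    p ^ (m - padicValNat p l) ∣ (p ^ m).choose l := by
  have := Fact.mk hp
  rcases Nat.eq_zero_or_pos ((p ^ m).choose l) with h0 | h0
  · rw [h0]; exact dvd_zero _
  obtain ⟨k, rfl⟩ := Nat.exists_eq_add_of_le' hl
  obtain ⟨n, hn⟩ := Nat.exists_eq_add_of_le' (Nat.one_le_pow m p hp.pos)
  -- l · C(q, l) = q · C(q - 1, l - 1).
  have h : p ^ m ∣ (p ^ m).choose (k + 1) * (k + 1) := by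
    rw [hn]
    exact ⟨_, (Nat.add_one_mul_choose_eq n k).symm⟩
  rw [padicValNat_dvd_iff_le (mul_ne_zero h0.ne' (by omega)),
    padicValNat.mul h0.ne' (by omega)] at h
  rw [padicValNat_dvd_iff_le h0.ne']
  omega

lemma padicValNat_factorial_mono (hp : p.Prime) {i j : ℕ} (h : i ≤ j) :
    padicValNat p i.factorial ≤ padicValNat p j.factorial := by
  have := Fact.mk hp
  exact (padicValNat_dvd_iff_le j.factorial_ne_zero).mp
    (pow_padicValNat_dvd.trans (Nat.factorial_dvd_factorial h))

lemma padicValNat_factorial_add_le (hp : p.Prime) (d : ℕ) {l : ℕ} (hl : 1 ≤ l) :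
    padicValNat p d.factorial + padicValNat p l ≤ padicValNat p (d + l).factorial := by
  have := Fact.mk hp
  rw [← padicValNat.mul d.factorial_ne_zero (by omega)]
  exact (padicValNat_dvd_iff_le (Nat.factorial_ne_zero _)).mp (pow_padicValNat_dvd.trans
    ((Nat.mul_dvd_mul_left _ (Nat.dvd_factorial hl le_rfl)).trans
      (Nat.factorial_mul_factorial_dvd_factorial_add d l)))

end Valuation

/-! ### Centrality modulo a normal subgroup -/

section CentralModulo

variable {K : Type v} [Group K]

/-- The preimage in `K` of the center of `K ⧸ V`. -/
def centerModulo (V : Subgroup K) [V.Normal] : Subgroup K :=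
  (Subgroup.center (K ⧸ V)).comap (QuotientGroup.mk' V)

instance centerModulo_normal (V : Subgroup K) [V.Normal] : (centerModulo V).Normal :=
  Subgroup.Normal.comap inferInstance _

variable {V : Subgroup K} [V.Normal]

lemma commute_mk_iff {a b : K} :
    Commute (QuotientGroup.mk' V a) (QuotientGroup.mk' V b) ↔ ⁅a, b⁆ ∈ V := by
  rw [← commutatorElement_eq_one_iff_commute, ← map_commutatorElement]
  exact QuotientGroup.eq_one_iff _

lemma mem_centerModulo_iff {a : K} : a ∈ centerModulo V ↔ ∀ k : K, ⁅a, k⁆ ∈ V := by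
  refine ⟨fun h k => commute_mk_iff.mp ?_, fun h => ?_⟩
  · exact (Subgroup.mem_center_iff.mp h _).symm
  · refine Subgroup.mem_center_iff.mpr fun x => ?_
    obtain ⟨k, rfl⟩ := QuotientGroup.mk'_surjective V x
    exact (commute_mk_iff.mpr (h k)).symm

lemma mem_centerModulo_of_closure {s : Set K} (hs : Subgroup.closure s = ⊤) {a : K}
    (h : ∀ k ∈ s, ⁅a, k⁆ ∈ V) : a ∈ centerModulo V := by
  rw [mem_centerModulo_iff]
  intro k
  have hk : k ∈ Subgroup.closure s := hs ▸ Subgroup.mem_top k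
  rw [← commute_mk_iff]
  induction hk using Subgroup.closure_induction with
  | mem x hx => exact commute_mk_iff.mpr (h x hx)
  | one => rw [map_one]; exact Commute.one_right _
  | mul x y _ _ hx hy => rw [map_mul]; exact hx.mul_right hy
  | inv x _ hx => rw [map_inv]; exact hx.inv_right

lemma mul_pow_mem_of_mem_centerModulo {a b : K} (hb : b ∈ centerModulo V) (n : ℕ) :
    (a ^ n * b ^ n)⁻¹ * (a * b) ^ n ∈ V := by
  have h : Commute (QuotientGroup.mk' V a) (QuotientGroup.mk' V b) :=
    (commute_mk_iff.mpr (mem_centerModulo_iff.mp hb a)).symm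
  rw [← QuotientGroup.eq]
  exact (h.mul_pow n).symm

lemma commutator_top_le_of_closure_pair {x y : K} (hs : Subgroup.closure {x, y} = ⊤)
    (h : ⁅x, y⁆ ∈ V) : ⁅(⊤ : Subgroup K), ⊤⁆ ≤ V := by
  have hx : x ∈ centerModulo V := mem_centerModulo_of_closure hs fun k hk => by
    rcases hk with rfl | rfl
    · rw [commutatorElement_self]; exact one_mem V
    · exact h
  have hy : y ∈ centerModulo V := mem_centerModulo_of_closure hs fun k hk => by
    rcases hk with rfl | rfl
    · rw [← commutatorElement_inv]; exact inv_mem h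
    · rw [commutatorElement_self]; exact one_mem V
  have : (⊤ : Subgroup K) ≤ centerModulo V := by
    rw [← hs, Subgroup.closure_le]
    rintro k (rfl | rfl) <;> assumption
  exact Subgroup.commutator_le.mpr fun g hg k _ => mem_centerModulo_iff.mp (this hg) k

end CentralModulo

/-! ### The filtration by powers of the lower central series -/

/-- The subgroup generated by the powers of exponent `p ^ (N - ord_p (i!))` of the elements of the
`i`-th term of the lower central series, for all `i ≥ j`. -/
def lcsPowers (K : Type v) [Group K] (p N j : ℕ) : Subgroup K :=
  Subgroup.closure {x | ∃ i, j ≤ i ∧ ∃ g ∈ lcsTerm K i,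
    g ^ p ^ (N - padicValNat p i.factorial) = x}

section LcsPowers

variable {K : Type v} [Group K] {p N : ℕ}

instance lcsPowers_normal (j : ℕ) : (lcsPowers K p N j).Normal := by
  refine ⟨fun x hx k => ?_⟩
  rw [lcsPowers] at hx
  induction hx using Subgroup.closure_induction with
  | mem x hx =>
    obtain ⟨i, hi, g, hg, rfl⟩ := hx
    exact Subgroup.subset_closure ⟨i, hi, _, (lcsTerm_normal i).conj_mem g hg k, conj_pow⟩
  | one => simp
  | mul x y _ _ hx hy => simpa using mul_mem hx hy
  | inv x _ hx => simpa [mul_assoc] using inv_mem hx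

lemma lcsPowers_antitone : Antitone (lcsPowers K p N) := fun _ _ h => by
  refine Subgroup.closure_mono ?_
  rintro _ ⟨i, hi, hx⟩
  exact ⟨i, h.trans hi, hx⟩

lemma pow_mem_lcsPowers {i j n : ℕ} {g : K} (hg : g ∈ lcsTerm K i) (hj : j ≤ i)
    (hn : p ^ (N - padicValNat p i.factorial) ∣ n) : g ^ n ∈ lcsPowers K p N j := by
  obtain ⟨k, rfl⟩ := hn
  rw [pow_mul]
  refine pow_mem (Subgroup.subset_closure ?_) k
  exact ⟨i, hj, g, hg, rfl⟩

lemma lcsPowers_eq_bot {c : ℕ} (hc : lcsTerm K (c + 1) = ⊥) : lcsPowers K p N (c + 1) = ⊥ := by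
  rw [lcsPowers, Subgroup.closure_eq_bot_iff]
  intro x hx
  obtain ⟨i, hi, g, hg, rfl⟩ := hx
  have : g = 1 := by simpa [hc] using lcsTerm_antitone hi hg
  simp [this]

lemma pow_choose_mem_lcsPowers (hp : p.Prime) {d l m j : ℕ} (hl : 1 ≤ l)
    (hm : N - padicValNat p d.factorial ≤ m) (hj : j ≤ d + l) {g : K}
    (hg : g ∈ lcsTerm K (d + l)) : g ^ (p ^ m).choose l ∈ lcsPowers K p N j := by
  refine pow_mem_lcsPowers hg hj ((pow_dvd_pow p ?_).trans
    (pow_sub_padicValNat_dvd_choose hp m hl))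
  have := padicValNat_factorial_add_le hp d hl
  omega

/-- The sequence n ↦ [g, k]^(-n) [g^n, k] has degree i and is trivial at 0 and 1, so its expansion
starts in K_{i+2}. -/
lemma commutator_pow_mem (hp : p.Prime) {i m : ℕ} (hi : 1 ≤ i)
    (hm : N - padicValNat p i.factorial ≤ m) {g : K} (hg : g ∈ lcsTerm K i) (k : K) :
    (⁅g, k⁆ ^ p ^ m)⁻¹ * ⁅g ^ p ^ m, k⁆ ∈ lcsPowers K p N (i + 2) := by
  obtain ⟨d, rfl⟩ := Nat.exists_eq_add_of_le' hi
  have hk : k ∈ lcsTerm K 1 := Subgroup.mem_top k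
  have h1 : PolySeq (d + 1) (fun n => ⁅g, k⁆ ^ n) :=
    PolySeq.pow (lcsTerm_antitone (by omega) (commutator_mem_lcsTerm hg hk))
  have h2 : PolySeq (d + 1) ⁅fun n => g ^ n, fun _ => k⁆ :=
    (PolySeq.pow (by rwa [add_comm])).comm (PolySeq.const hk)
  refine (h1.inv.mul h2).mem_of_choose ?_ ?_ (p ^ m) _ fun l hl x hx =>
    pow_choose_mem_lcsPowers hp (by omega) hm (by omega) hx
  · simp [commutatorElement_def]
  · simp [commutatorElement_def, mul_assoc]

lemma mul_pow_mem (hp : p.Prime) {i : ℕ} (hi : 1 ≤ i) {g h : K} (hg : g ∈ lcsTerm K i)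
    (hh : h ∈ lcsTerm K i) :
    (g ^ p ^ N * h ^ p ^ N)⁻¹ * (g * h) ^ p ^ N ∈ lcsPowers K p N (i + 1) := by
  obtain ⟨d, rfl⟩ := Nat.exists_eq_add_of_le' hi
  have key : ∀ {x : K}, x ∈ lcsTerm K (d + 1) → PolySeq d (fun n => x ^ n) := fun hx =>
    PolySeq.pow (by rwa [add_comm])
  refine (((key hg).mul (key hh)).inv.mul (key (mul_mem hg hh))).mem_of_choose ?_ ?_ (p ^ N) _
    fun l hl x hx => pow_choose_mem_lcsPowers hp (by omega) (Nat.sub_le _ _) (by omega) hx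
  · simp
  · simp

lemma lcsPowers_le_centerModulo (hp : p.Prime) {j : ℕ} (hj : 1 ≤ j) :
    lcsPowers K p N j ≤ centerModulo (lcsPowers K p N (j + 1)) := by
  rw [lcsPowers, Subgroup.closure_le]
  rintro _ ⟨i, hi, g, hg, rfl⟩
  refine mem_centerModulo_iff.mpr fun k => ?_
  have h1 := lcsPowers_antitone (by omega : j + 1 ≤ i + 2)
    (commutator_pow_mem (N := N) hp (hj.trans hi) le_rfl hg k)
  have h2 : ⁅g, k⁆ ^ p ^ (N - padicValNat p i.factorial) ∈ lcsPowers K p N (j + 1) :=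
    pow_mem_lcsPowers (commutator_mem_lcsTerm (j := 1) hg (Subgroup.mem_top k))
      (by omega) (pow_dvd_pow p (Nat.sub_le_sub_left
        (padicValNat_factorial_mono hp (Nat.le_succ i)) N))
  simpa using mul_mem h2 h1

/-- On generators, [g, k]^q agrees with [g^q, k] modulo W_{i+2}, and the latter lies there by
centrality. -/
lemma pow_mem_lcsPowers_succ (hp : p.Prime) {i : ℕ} (hi : 1 ≤ i)
    (h : ∀ g ∈ lcsTerm K i, g ^ p ^ N ∈ centerModulo (lcsPowers K p N (i + 2))) :
    ∀ g ∈ lcsTerm K (i + 1), g ^ p ^ N ∈ lcsPowers K p N (i + 2) := by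
  intro g hg
  rw [lcsTerm_succ hi, Subgroup.commutator_def] at hg
  have hle : ∀ x ∈ Subgroup.closure {g | ∃ g₁ ∈ lcsTerm K i, ∃ g₂ ∈ (⊤ : Subgroup K), ⁅g₁, g₂⁆ = g},
      x ∈ lcsTerm K (i + 1) := fun x hx => by
    rwa [lcsTerm_succ hi, Subgroup.commutator_def]
  induction hg using Subgroup.closure_induction with
  | mem x hx =>
    obtain ⟨g, hg, k, -, rfl⟩ := hx
    have h1 := commutator_pow_mem (N := N) hp hi (Nat.sub_le N _) hg k
    have h2 := mem_centerModulo_iff.mp (h g hg) k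
    exact inv_mem_iff.mp ((Subgroup.mul_mem_cancel_right _ h2).mp h1)
  | one => rw [one_pow]; exact one_mem _
  | mul x y hx hy h1 h2 =>
    have h3 := mul_pow_mem (N := N) hp (by omega) (hle x hx) (hle y hy)
    exact (Subgroup.mul_mem_cancel_left _ (inv_mem (mul_mem h1 h2))).mp h3
  | inv x _ h1 => rw [inv_pow]; exact inv_mem h1

lemma pow_mem_lcsPowers_of_three_le (hp : p.Prime)
    (h : ∀ g ∈ lcsTerm K 2, g ^ p ^ N ∈ centerModulo (lcsPowers K p N 4)) {i : ℕ} (hi : 3 ≤ i) :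
    ∀ g ∈ lcsTerm K i, g ^ p ^ N ∈ lcsPowers K p N (i + 1) := by
  induction hi with
  | refl => exact pow_mem_lcsPowers_succ hp (by omega) h
  | @step i hi ih =>
    exact pow_mem_lcsPowers_succ hp (by simp at hi; omega) fun g hg =>
      lcsPowers_le_centerModulo hp (by omega) (ih g hg)

/-- [x, y]^q differs from [x^q, y] by an element of W_3, which is central modulo W_4. -/
lemma commutator_commutator_pow_mem (hp : p.Prime) {x y : K}
    (hxy : Commute ⁅x ^ p ^ N, y⁆ y) : ⁅⁅x, y⁆ ^ p ^ N, y⁆ ∈ lcsPowers K p N 4 := by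
  have hz := lcsPowers_le_centerModulo hp (by omega)
    (commutator_pow_mem (N := N) hp le_rfl (Nat.sub_le N _) (Subgroup.mem_top x) y)
  have h1 := (commute_mk_iff (V := lcsPowers K p N 4)).mpr (mem_centerModulo_iff.mp hz y)
  have h2 := (hxy.map (QuotientGroup.mk' (lcsPowers K p N 4))).mul_left h1.inv_left
  rw [← commute_mk_iff]
  simpa only [map_mul, map_inv, mul_inv_rev, inv_inv, mul_inv_cancel_left] using h2

lemma pow_mem_centerModulo (hp : p.Prime) {x y : K} (hs : Subgroup.closure {x, y} = ⊤)
    (hxy : Commute ⁅x ^ p ^ N, y⁆ y) (hyx : Commute ⁅y ^ p ^ N, x⁆ x) :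
    ∀ g ∈ lcsTerm K 2, g ^ p ^ N ∈ centerModulo (lcsPowers K p N 4) := by
  have hc : ⁅x, y⁆ ^ p ^ N ∈ centerModulo (lcsPowers K p N 4) := by
    refine mem_centerModulo_of_closure hs fun k hk => ?_
    rcases hk with rfl | rfl
    · have h := commutator_commutator_pow_mem hp hyx
      rw [← commutatorElement_inv k y, inv_pow, ← commute_mk_iff, map_inv,
        Commute.inv_left_iff] at h
      exact commute_mk_iff.mp h
    · exact commutator_commutator_pow_mem hp hxy
  -- T is normal and contains [x, y], whose normal closure is K_2 because x, y generate K.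
  let T : Subgroup K :=
    { carrier := {g | g ∈ lcsTerm K 2 ∧ g ^ p ^ N ∈ centerModulo (lcsPowers K p N 4)}
      one_mem' := ⟨one_mem _, by rw [one_pow]; exact one_mem _⟩
      mul_mem' := fun {a b} ha hb => ⟨mul_mem ha.1 hb.1, by
        have h := lcsPowers_le_centerModulo hp (by omega)
          (mul_pow_mem (N := N) hp (by omega) ha.1 hb.1)
        exact (Subgroup.mul_mem_cancel_left _ (inv_mem (mul_mem ha.2 hb.2))).mp h⟩
      inv_mem' := fun {a} ha => ⟨inv_mem ha.1, by rw [inv_pow]; exact inv_mem ha.2⟩ }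
  have : T.Normal := ⟨fun a ha k => ⟨(lcsTerm_normal 2).conj_mem a ha.1 k, by
    rw [conj_pow]; exact (centerModulo_normal _).conj_mem _ ha.2 k⟩⟩
  have hT : ⁅x, y⁆ ∈ T :=
    ⟨commutator_mem_lcsTerm (i := 1) (j := 1) (Subgroup.mem_top x) (Subgroup.mem_top y), hc⟩
  exact fun g hg => (commutator_top_le_of_closure_pair hs hT hg).2

lemma pow_mem_lcsPowers_of_mem_lcsPowers (hp : p.Prime) {c : ℕ} (hc : lcsTerm K (c + 1) = ⊥)
    (h : ∀ g ∈ lcsTerm K 2, g ^ p ^ N ∈ centerModulo (lcsPowers K p N 4)) {j : ℕ} (hj : 3 ≤ j)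
    {b : K} (hb : b ∈ lcsPowers K p N j) :
    b ^ p ^ padicValNat p c.factorial ∈ lcsPowers K p N (j + 1) := by
  have hz := lcsPowers_le_centerModulo (K := K) (N := N) hp (by omega : 1 ≤ j)
  rw [lcsPowers] at hb
  induction hb using Subgroup.closure_induction with
  | mem x hx =>
    obtain ⟨i, hi, g, hg, rfl⟩ := hx
    rcases Nat.lt_or_ge c i with hci | hci
    · have : g = 1 := by simpa [hc] using lcsTerm_antitone hci hg
      rw [this, one_pow, one_pow]
      exact one_mem _
    · have h1 := pow_mem_lcsPowers_of_three_le hp h (hj.trans hi) g hg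
      -- For i ≤ c, ord_p(c!) makes up for the loss ord_p(i!) in the exponent.
      have h2 : p ^ N ∣ p ^ (N - padicValNat p i.factorial) * p ^ padicValNat p c.factorial := by
        rw [← pow_add]
        refine pow_dvd_pow p ?_
        have := padicValNat_factorial_mono hp hci
        omega
      obtain ⟨k, hk⟩ := h2
      rw [← pow_mul, hk, pow_mul]
      exact pow_mem (lcsPowers_antitone (by omega) h1) k
  | one => rw [one_pow]; exact one_mem _
  | mul x y _ hy h1 h2 =>
    exact (Subgroup.mul_mem_cancel_left _ (inv_mem (mul_mem h1 h2))).mp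
      (mul_pow_mem_of_mem_centerModulo (hz hy) (p ^ padicValNat p c.factorial))
  | inv x _ h1 => rw [inv_pow]; exact inv_mem h1

lemma mul_pow_eq (hp : p.Prime) {c : ℕ} (hc2 : 2 ≤ c) (hc : lcsTerm K (c + 1) = ⊥)
    (h : ∀ g ∈ lcsTerm K 2, g ^ p ^ N ∈ centerModulo (lcsPowers K p N 4)) (a : K) {b : K}
    (hb : b ∈ lcsPowers K p N 3) {n : ℕ} (hn : (c - 2) * padicValNat p c.factorial ≤ n) :
    (a * b) ^ p ^ n = a ^ p ^ n := by
  have key : ∀ t, (a ^ p ^ (t * padicValNat p c.factorial))⁻¹ *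
      (a * b) ^ p ^ (t * padicValNat p c.factorial) ∈ lcsPowers K p N (3 + t) := by
    intro t
    induction t with
    | zero => simpa using hb
    | succ t ih =>
      have h1 := pow_mem_lcsPowers_of_mem_lcsPowers hp hc h (by omega) ih
      have h2 := mul_pow_mem_of_mem_centerModulo (a := a ^ p ^ (t * padicValNat p c.factorial))
        (lcsPowers_le_centerModulo hp (by omega) ih) (p ^ padicValNat p c.factorial)
      rw [mul_inv_cancel_left, mul_inv_rev, mul_assoc, ← pow_mul, ← pow_mul, ← pow_add,
        ← Nat.succ_mul] at h2
      simpa only [mul_inv_cancel_left, add_assoc] using mul_mem h1 h2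
  have h0 := key (c - 2)
  rw [show 3 + (c - 2) = c + 1 by omega, lcsPowers_eq_bot hc, Subgroup.mem_bot,
    inv_mul_eq_one] at h0
  rw [← Nat.add_sub_of_le hn, pow_add, pow_mul (a * b), pow_mul a, h0]

lemma commutator_pow_pow_eq_of_closure (hp : p.Prime) {c : ℕ} (hc2 : 2 ≤ c)
    (hc : NilpotentClassLE c K) {x y : K} (hs : Subgroup.closure {x, y} = ⊤)
    (hxy : Commute ⁅x ^ p ^ N, y⁆ y) (hyx : Commute ⁅y ^ p ^ N, x⁆ x) {n : ℕ}
    (hn : (c - 2) * padicValNat p c.factorial ≤ n) :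
    ⁅x ^ p ^ N, y⁆ ^ p ^ n = ⁅x, y ^ p ^ N⁆ ^ p ^ n := by
  have hz := pow_mem_centerModulo hp hs hxy hyx
  have key : ∀ x y : K, ⁅x ^ p ^ N, y⁆ ^ p ^ n = (⁅x, y⁆ ^ p ^ N) ^ p ^ n := fun x y => by
    simpa using mul_pow_eq hp hc2 hc hz (⁅x, y⁆ ^ p ^ N)
      (commutator_pow_mem (N := N) hp le_rfl (Nat.sub_le N _) (Subgroup.mem_top x) y) hn
  rw [key, ← commutatorElement_inv (y ^ p ^ N), inv_pow, key, ← inv_pow, ← inv_pow,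
    commutatorElement_inv]

lemma commutator_pow_pow_eq (hp : p.Prime) {c : ℕ} (hc2 : 2 ≤ c)
    (hc : NilpotentClassLE c K) {x y : K}
    (hxy : Commute ⁅x ^ p ^ N, y⁆ y) (hyx : Commute ⁅y ^ p ^ N, x⁆ x) {n : ℕ}
    (hn : (c - 2) * padicValNat p c.factorial ≤ n) :
    ⁅x ^ p ^ N, y⁆ ^ p ^ n = ⁅x, y ^ p ^ N⁆ ^ p ^ n := by
  -- All elements involved lie in this subgroup, so K may be taken 2-generated.
  let S := Subgroup.closure {x, y}
  have hS : NilpotentClassLE c S := by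
    rw [NilpotentClassLE, ← Subgroup.map_eq_bot_iff_of_injective _ S.subtype_injective,
      Subgroup.top_subtype_lowerCentralSeries, eq_bot_iff, ← show _ = _ from hc]
    exact Subgroup.lowerCentralSeries_mono c le_top
  let x' : S := ⟨x, Subgroup.subset_closure (by simp)⟩
  let y' : S := ⟨y, Subgroup.subset_closure (by simp)⟩
  have hs : Subgroup.closure {x', y'} = ⊤ := by
    rw [← Subgroup.closure_closure_coe_preimage (k := ({x, y} : Set K))]
    congr 1
    ext z
    simp [x', y', Subtype.ext_iff, S]
  exact congrArg Subtype.val (commutator_pow_pow_eq_of_closure (x := x') (y := y') hp hc2 hS hs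
    (Subtype.ext hxy) (Subtype.ext hyx) hn)

end LcsPowers

/-! ### Class two and the dominion -/

section ClassTwo

variable {G : Type u} [Group G]

lemma NilpotentClassLE.commute_commutator (hG : NilpotentClassLE 2 G) (x y z : G) :
    Commute ⁅x, y⁆ z := by
  rw [← commutatorElement_eq_one_iff_commute, ← Subgroup.mem_bot, ← show _ = _ from hG]
  exact Subgroup.commutator_mem_commutator
    (Subgroup.commutator_mem_commutator (Subgroup.mem_top x) (Subgroup.mem_top y))
    (Subgroup.mem_top z)

lemma NilpotentClassLE.commutator_pow_left (hG : NilpotentClassLE 2 G) (x y : G) (n : ℕ) :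
    ⁅x ^ n, y⁆ = ⁅x, y⁆ ^ n := by
  induction n with
  | zero => simp
  | succ n ih =>
    rw [pow_succ, commutatorElement_mul_left_eq_conj_mul, ih,
      ← (hG.commute_commutator x y (x ^ n)).eq, mul_inv_cancel_right, pow_succ']

lemma NilpotentClassLE.commutator_pow_right (hG : NilpotentClassLE 2 G) (x y : G) (n : ℕ) :
    ⁅x, y ^ n⁆ = ⁅x, y⁆ ^ n := by
  rw [← commutatorElement_inv, hG.commutator_pow_left, ← inv_pow, commutatorElement_inv]

end ClassTwo

theorem theorem8p86 (c : ℕ) (hc : 1 < c) (p : ℕ) (hp : p.Prime)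
    (G : Type u) [Group G] (hG : NilpotentClassLE 2 G) (H : Subgroup G)
    (a N : ℕ) (hN : (c - 2) * padicValNat p c.factorial + a ≤ N)
    (x y : G) (hx : x ^ p ^ N ∈ H) (hy : y ^ p ^ N ∈ H) :
    rightCommutator x y ^ p ^ (2 * N - a) ∈
      dominion (fun (K : Type v) [Group K] => NilpotentClassLE c K) H := by
  intro K _ hK f g hfg
  have hxy : rightCommutator x y = ⁅x⁻¹, y⁻¹⁆ := by
    rw [rightCommutator, commutatorElement_def, inv_inv, inv_inv]
  replace hx : x⁻¹ ^ p ^ N ∈ H := by rw [inv_pow]; exact inv_mem hx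
  replace hy : y⁻¹ ^ p ^ N ∈ H := by rw [inv_pow]; exact inv_mem hy
  rw [hxy]
  -- Inverting x and y absorbs the difference between the two commutator conventions.
  generalize x⁻¹ = x at *
  generalize y⁻¹ = y at *
  have hfx := hfg _ hx
  have hfy := hfg _ hy
  have hl : ⁅x, y⁆ ^ p ^ (2 * N - a) = ⁅x ^ p ^ N, y⁆ ^ p ^ (N - a) := by
    rw [hG.commutator_pow_left, ← pow_mul, ← pow_add]
    congr 2
    omega
  have hr : ⁅x, y⁆ ^ p ^ (2 * N - a) = ⁅x, y ^ p ^ N⁆ ^ p ^ (N - a) := by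
    rw [hl, hG.commutator_pow_left, hG.commutator_pow_right]
  -- In the mixed pair (g x, f y), a q-th power in either entry turns the commutator into a value of
  -- f or of g.
  have h1 : ⁅g x ^ p ^ N, f y⁆ = f ⁅x ^ p ^ N, y⁆ := by
    rw [map_commutatorElement, hfx, map_pow]
  have h2 : ⁅f y ^ p ^ N, g x⁆ = g ⁅y ^ p ^ N, x⁆ := by
    rw [map_commutatorElement, ← hfy, map_pow]
  have h3 : ⁅g x, f y ^ p ^ N⁆ = g ⁅x, y ^ p ^ N⁆ := by
    rw [map_commutatorElement, ← hfy, map_pow]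
  have key := commutator_pow_pow_eq (x := g x) (y := f y) (N := N) (n := N - a) hp hc hK
    (by rw [h1]; exact (hG.commute_commutator _ _ _).map f)
    (by rw [h2]; exact (hG.commute_commutator _ _ _).map g) (by omega)
  rw [h1, h3, ← map_pow, ← map_pow, ← hl, ← hr] at key
  exact key
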